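/- Let $n\ge 1$, let $m_1,\dots,m_n\ge 1$ be integers and put $M=m_1+\dots+m_n$. Let $N$ be the number of (distinct) permutations of the multiset $1^{m_1}2^{m_2}\cdots n^{m_n}$ that contain $1,2,\dots,n$ as a (not necessarily contiguous) subsequence. Let $\tau_n$ be uniformly distributed on all permutations of this multiset, and let $L_n$ be the largest $\ell\le n$ such that $1,2,\dots,\ell$ is a subsequence of $\tau_n$. Then $$N=\frac{M!}{m_1!\cdots m_n!}\,\mathbb P(L_n=n)=(-1)^M\sum_{j=0}^{M}\binom{M}{j}\,j!\,c_j,\qquad c_j=(-1)^n[\theta^j]\prod_{i=1}^n E_{m_i-1}(-\theta),$$ where $E_k(x)=\sum_{i=0}^{k}x^i/i!$ and $[\theta^j]f(\theta)$ denotes the coefficient of $\theta^j$ in $f$. Moreover, if $X_1,\dots,X_n$ are independent random variables such that $X_i$ has the beta$(1,m_i)$ distribution, and $S_n=X_1+\dots+X_n$, then $$N=\frac{M!}{m_1!\cdots m_n!}\,\mathbb P(S_n\le 1).$$ -/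

import Mathlib

open MeasureTheory ProbabilityTheory

/-- The multiset `1^{m_1} 2^{m_2} ⋯ n^{m_n}`; the multiplicity of the letter `i + 1` is
`m i`, for `i : Fin n` (counted from `0`). -/
def multisetOf {n : ℕ} (m : Fin n → ℕ) : Multiset ℕ :=
  ∑ i : Fin n, Multiset.replicate (m i) ((i : ℕ) + 1)

/-- The (distinct) permutations of the multiset `1^{m_1} ⋯ n^{m_n}`, written as words. -/
def multisetPerms {n : ℕ} (m : Fin n → ℕ) : Finset (List ℕ) :=
  (multisetOf m).lists.toFinset

theorem mem_multisetPerms {n : ℕ} (m : Fin n → ℕ) (w : List ℕ) :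
    w ∈ multisetPerms m ↔ (w : Multiset ℕ) = multisetOf m := by
  rw [multisetPerms, Multiset.mem_toFinset, Multiset.mem_lists_iff]
  exact eq_comm

theorem multisetPerms_nonempty {n : ℕ} (m : Fin n → ℕ) : (multisetPerms m).Nonempty :=
  ⟨(multisetOf m).toList, (mem_multisetPerms m _).2 (Multiset.coe_toList _)⟩

/-- The law of the uniformly random permutation `τ_n` of `1^{m_1} ⋯ n^{m_n}`. -/
noncomputable def uniformMultisetPerm {n : ℕ} (m : Fin n → ℕ) : PMF (List ℕ) :=
  PMF.uniformOfFinset (multisetPerms m) (multisetPerms_nonempty m)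

/-- The largest `ℓ ≤ n` such that `1, 2, …, ℓ` is a (not necessarily contiguous) subsequence
of the word `w`. -/
def longestContinuous (n : ℕ) (w : List ℕ) : ℕ :=
  Nat.findGreatest (fun ℓ => (List.range' 1 ℓ).Sublist w) n

/-- The law of `L_n`, the statistic `longestContinuous n` of the uniformly random
permutation of `1^{m_1} ⋯ n^{m_n}`. -/
noncomputable def lawL {n : ℕ} (m : Fin n → ℕ) : PMF ℕ :=
  (uniformMultisetPerm m).map (longestContinuous n)

/-- The truncated exponential polynomial `E_k(x) = ∑_{i=0}^{k} x^i / i!`. -/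
noncomputable def truncExp (k : ℕ) : Polynomial ℝ :=
  ∑ i ∈ Finset.range (k + 1), Polynomial.monomial i (1 / (i.factorial : ℝ))

/-- `c_j = (-1)^n [θ^j] ∏_{i=1}^{n} E_{m_i - 1}(-θ)`. -/
noncomputable def coeffC {n : ℕ} (m : Fin n → ℕ) (j : ℕ) : ℝ :=
  (-1) ^ n * (∏ i : Fin n, (truncExp (m i - 1)).comp (-Polynomial.X)).coeff j

/-! Write B_x for the functional X^a ↦ x^a/a! and p_m for `hitPoly m`. The count and the beta
probability are multiples of one number, B_1(∏ p_{m_i}), by factors M! and ∏ m_i!.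

For words, give each letter of multiplicity k the factor p_k if it is still to be found and 1/k!
otherwise. The Leibniz rule for X d/dX removes one copy of a letter at a time, and B_1(X (Xq)') =
B_1(q) accounts for reading the next required letter. So M! B_1 satisfies the first-letter recursion
of the count (`borelEval_contentPoly_recursion`, `card_wordsContaining`).

For beta variables, convolution with (1 - y)^(m-1)/(m-1)! is multiplication by p_m under B_x, by
repeated integration by parts (`integral_one_sub_pow_mul_borelEval`). Reversing the coefficients of
∏ p_{m_i} yields the truncated exponentials, hence the explicit sum. -/

/-! ### The functional `X ^ a ↦ x ^ a / a!` and the hitting polynomials -/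

section Polynomials

open Polynomial

/-- The linear functional on polynomials sending `X ^ a` to `x ^ a / a!`. -/
noncomputable def borelEval (x : ℝ) : ℝ[X] →ₗ[ℝ] ℝ :=
  Polynomial.lsum fun a => (x ^ a / (a.factorial : ℝ)) • LinearMap.id

theorem borelEval_monomial (x : ℝ) (a : ℕ) (c : ℝ) :
    borelEval x (monomial a c) = x ^ a / (a.factorial : ℝ) * c := by
  simp [borelEval, Polynomial.lsum_apply]

theorem borelEval_C (x c : ℝ) : borelEval x (C c) = c := by
  simpa using borelEval_monomial x 0 c

theorem borelEval_eq_sum_range (x : ℝ) {p : ℝ[X]} {N : ℕ} (hp : p.natDegree ≤ N) :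
    borelEval x p = ∑ a ∈ Finset.range (N + 1), x ^ a / (a.factorial : ℝ) * p.coeff a := by
  conv_lhs => rw [p.as_sum_range' (N + 1) (by omega)]
  simp [borelEval_monomial]

/-- The operator `X * d/dX` inverts multiplication by `X` under `borelEval 1`. -/
theorem borelEval_X_mul_derivative_X_mul (q : ℝ[X]) :
    borelEval 1 (X * derivative (X * q)) = borelEval 1 q := by
  induction q using Polynomial.induction_on' with
  | add p q hp hq => simp only [mul_add, map_add] at *; rw [hp, hq]
  | monomial a c =>
    rw [X_mul_monomial, derivative_monomial, X_mul_monomial, borelEval_monomial,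
      borelEval_monomial]
    have h : (a.factorial : ℝ) ≠ 0 := by positivity
    simp only [Nat.add_sub_cancel, Nat.factorial_succ]
    push_cast
    field_simp
    simp

/-- The polynomial `∑_{k=1}^{m} (-1)^(k-1) X^k / (m-k)!`, given by its recursion. -/
noncomputable def hitPoly : ℕ → ℝ[X]
  | 0 => 0
  | m + 1 => X * (C (1 / (m.factorial : ℝ)) - hitPoly m)

/-- On coefficients this is k = (m+1) - (m+1-k) together with (m+1-k)/(m+1-k)! = 1/(m-k)!. The
constants 1/m! obey the same rule, so both kinds of letter are treated alike. -/
theorem X_mul_derivative_hitPoly (m : ℕ) :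
    X * derivative (hitPoly (m + 1)) = ((m + 1 : ℕ) : ℝ[X]) * hitPoly (m + 1) - hitPoly m := by
  induction m with
  | zero => simp [hitPoly]
  | succ m ih =>
    have h : (C (1 / ((m + 1).factorial : ℝ)) : ℝ[X]) * ((m + 1 : ℕ) : ℝ[X])
        = C (1 / (m.factorial : ℝ)) := by
      rw [← C_eq_natCast, ← C_mul, Nat.factorial_succ]
      congr 1
      push_cast
      field_simp
    rw [hitPoly, derivative_mul, derivative_X, derivative_sub, derivative_C, zero_sub]
    have h2 : hitPoly (m + 1) = X * (C (1 / (m.factorial : ℝ)) - hitPoly m) := rfl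
    push_cast at *
    linear_combination (-X) * ih - X * h + h2

theorem natDegree_hitPoly_le (m : ℕ) : (hitPoly m).natDegree ≤ m := by
  induction m with
  | zero => simp [hitPoly]
  | succ m ih =>
    rw [hitPoly, add_comm]
    exact natDegree_mul_le_of_le natDegree_X_le
      ((natDegree_sub_le_of_le (natDegree_C _).le ih).trans (by simp))

theorem reflect_hitPoly_succ (m : ℕ) :
    reflect (m + 1) (hitPoly (m + 1)) = (-1) ^ m * (truncExp m).comp (-X) := by
  have key : ∀ k, reflect (k + 1) (hitPoly (k + 1))
      = C (1 / (k.factorial : ℝ)) * X ^ k - reflect k (hitPoly k) := by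
    intro k
    rw [hitPoly, add_comm k 1, reflect_mul _ _ (natDegree_X_le (R := ℝ)) (G := k),
      reflect_one_X, one_mul, reflect_sub, reflect_C]
    exact (natDegree_sub_le_of_le (by simp) (natDegree_hitPoly_le k)).trans (max_self k).le
  have key2 : ∀ k, (truncExp k).comp (-X)
      = ∑ i ∈ Finset.range (k + 1), C (1 / (i.factorial : ℝ)) * (-X) ^ i := by
    intro k
    simp [truncExp, Polynomial.sum_comp, Polynomial.monomial_comp]
  induction m with
  | zero => rw [key, key2]; simp [hitPoly]
  | succ m ih =>
    rw [key, ih, key2, key2, Finset.sum_range_succ _ (m + 1), neg_pow (X : ℝ[X]) (m + 1)]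
    have : ((-1 : ℝ[X]) ^ (m + 1)) * (-1) ^ (m + 1) = 1 := by
      rw [← mul_pow]; simp
    linear_combination (-C (1 / ((m + 1).factorial : ℝ)) * X ^ (m + 1)) * this

theorem natDegree_prod_hitPoly_le {ι : Type*} (s : Finset ι) (m : ι → ℕ) :
    (∏ i ∈ s, hitPoly (m i)).natDegree ≤ ∑ i ∈ s, m i :=
  (natDegree_prod_le _ _).trans (Finset.sum_le_sum fun i _ => natDegree_hitPoly_le (m i))

theorem reflect_prod_hitPoly {ι : Type*} (s : Finset ι) (m : ι → ℕ) :
    reflect (∑ i ∈ s, m i) (∏ i ∈ s, hitPoly (m i)) = ∏ i ∈ s, reflect (m i) (hitPoly (m i)) := by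
  classical
  induction s using Finset.induction_on with
  | empty => simp
  | insert a s ha ih =>
    rw [Finset.prod_insert ha, Finset.prod_insert ha, Finset.sum_insert ha,
      reflect_mul _ _ (natDegree_hitPoly_le _) (natDegree_prod_hitPoly_le s m), ih]

/-- The explicit formula for `borelEval 1` of a product of hitting polynomials. -/
theorem factorial_mul_borelEval_prod_hitPoly {n : ℕ} (m : Fin n → ℕ) (hm : ∀ i, 1 ≤ m i) :
    ((∑ i, m i).factorial : ℝ) * borelEval 1 (∏ i, hitPoly (m i))
      = (-1) ^ (∑ i, m i) * ∑ j ∈ Finset.range (∑ i, m i + 1),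
          ((∑ i, m i).choose j : ℝ) * (j.factorial : ℝ) * coeffC m j := by
  set M := ∑ i, m i with hM
  have hrefl : reflect M (∏ i, hitPoly (m i))
      = C ((-1) ^ M * (-1) ^ n) * ∏ i, (truncExp (m i - 1)).comp (-X) := by
    rw [hM, reflect_prod_hitPoly]
    have : ∀ i, reflect (m i) (hitPoly (m i))
        = ((-1) ^ (m i) * (-1)) * (truncExp (m i - 1)).comp (-X) := by
      intro i
      -- Positivity of `m i` matters: `hitPoly 0` is 0, whereas `truncExp (0 - 1)` is 1.
      obtain ⟨k, hk⟩ := Nat.exists_eq_add_of_le' (hm i)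
      rw [hk, reflect_hitPoly_succ, pow_succ]
      simp
    simp only [this, Finset.prod_mul_distrib, Finset.prod_pow_eq_pow_sum]
    simp
  -- Reindexing by j ↦ M - j turns the weight 1/(M-j)! into binom(M, j) j!/M!.
  rw [borelEval_eq_sum_range 1 (natDegree_prod_hitPoly_le _ m), ← hM,
    ← Finset.sum_range_reflect, Finset.mul_sum, Finset.mul_sum]
  refine Finset.sum_congr rfl fun j hj => ?_
  have hj' : j ≤ M := Nat.lt_succ_iff.1 (Finset.mem_range.1 hj)
  have h1 : (∏ i, hitPoly (m i)).coeff (M - j)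
      = (-1) ^ M * coeffC m j := by
    have := congrArg (fun p => coeff p j) hrefl
    simp only [coeff_reflect, coeff_C_mul, revAt_le hj'] at this
    rw [this, coeffC, mul_assoc]
  have h2 : M + 1 - 1 - j = M - j := by omega
  have h3 : (M.choose j : ℝ) * (j.factorial : ℝ) * ((M - j).factorial : ℝ) = M.factorial := by
    exact_mod_cast Nat.choose_mul_factorial_mul_factorial hj'
  rw [h2, h1, ← h3]
  field_simp
  simp

end Polynomials

/-! ### Counting words that contain a given subsequence -/

section Words

open Polynomial

variable {α : Type*} [DecidableEq α]

/-- The words with letter content `S` which contain `L` as a subsequence. -/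
def wordsContaining (S : Multiset α) (L : List α) : Finset (List α) :=
  S.lists.toFinset.filter fun w => L.Sublist w

theorem mem_wordsContaining {S : Multiset α} {L w : List α} :
    w ∈ wordsContaining S L ↔ (w : Multiset α) = S ∧ L.Sublist w := by
  simp [wordsContaining, Multiset.mem_lists_iff, eq_comm]

/-- What is left to find of the subsequence `L` after reading the letter `c`. -/
def advance (c : α) : List α → List α
  | [] => []
  | a :: L => if a = c then L else a :: L

/-- Greedy matching loses nothing: an embedding that skips a usable first letter can be moved to use
it. -/
theorem sublist_cons_iff_advance (c : α) (L w : List α) :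
    L.Sublist (c :: w) ↔ (advance c L).Sublist w := by
  cases L with
  | nil => simp [advance]
  | cons a L =>
    rw [advance, List.cons_sublist_cons']
    split_ifs with h
    · exact ⟨fun h' => h'.elim (fun h'' => (List.sublist_cons_self a L).trans h'') (·.2),
        fun h' => Or.inr ⟨h, h'⟩⟩
    · simp [h]

theorem card_wordsContaining_eq_sum {S : Multiset α} (hS : S ≠ 0) (L : List α) :
    (wordsContaining S L).card
      = ∑ c ∈ S.toFinset, (wordsContaining (S.erase c) (advance c L)).card := by
  have : wordsContaining S L = S.toFinset.biUnion fun c =>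
      (wordsContaining (S.erase c) (advance c L)).image (List.cons c) := by
    ext w
    simp only [mem_wordsContaining, Finset.mem_biUnion, Multiset.mem_toFinset, Finset.mem_image]
    constructor
    · rintro ⟨h, hL⟩
      cases w with
      | nil => exact absurd h.symm hS
      | cons c w =>
        refine ⟨c, by simp [← h], w, ⟨by simp [← h], (sublist_cons_iff_advance c L w).1 hL⟩, rfl⟩
    · rintro ⟨c, hc, w, ⟨h, hL⟩, rfl⟩
      refine ⟨?_, (sublist_cons_iff_advance c L w).2 hL⟩
      rw [← Multiset.cons_coe, h, Multiset.cons_erase hc]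
  rw [this, Finset.card_biUnion]
  · exact Finset.sum_congr rfl fun c _ =>
      Finset.card_image_of_injective _ (List.cons_injective)
  · intro c _ d _ hcd
    rw [Function.onFun, Finset.disjoint_left]
    simp only [Finset.mem_image]
    rintro w ⟨u, _, rfl⟩ ⟨v, _, h⟩
    exact hcd (List.cons.inj h).1.symm

/-- The factor of a letter of multiplicity `k`; `b` tells whether it occurs in the subsequence
still to be found. -/
noncomputable def letterPoly (b : Prop) [Decidable b] (k : ℕ) : ℝ[X] :=
  if b then hitPoly k else C (1 / (k.factorial : ℝ))

theorem X_mul_derivative_letterPoly_zero (b : Prop) [Decidable b] :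
    X * derivative (letterPoly b 0) = 0 := by
  unfold letterPoly
  split_ifs <;> simp [hitPoly]

theorem X_mul_derivative_letterPoly_succ (b : Prop) [Decidable b] (k : ℕ) :
    X * derivative (letterPoly b (k + 1))
      = ((k + 1 : ℕ) : ℝ[X]) * letterPoly b (k + 1) - letterPoly b k := by
  unfold letterPoly
  split_ifs
  · exact X_mul_derivative_hitPoly k
  · rw [derivative_C, ← C_eq_natCast, ← C_mul, ← C_sub, mul_zero, Nat.factorial_succ]
    symm
    rw [C_eq_zero]
    push_cast
    field_simp
    simp

/-- The generating polynomial for the words of content `S` containing `L`. -/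
noncomputable def contentPoly (T : Finset α) (S : Multiset α) (L : List α) : ℝ[X] :=
  ∏ c ∈ T, letterPoly (c ∈ L) (S.count c)

theorem contentPoly_erase {T : Finset α} {S : Multiset α} {c : α} (hcT : c ∈ T) (L : List α) :
    contentPoly T (S.erase c) L
      = (∏ d ∈ T.erase c, letterPoly (d ∈ L) (S.count d)) *
        letterPoly (c ∈ L) (S.count c - 1) := by
  rw [contentPoly, ← Finset.prod_erase_mul _ _ hcT, Multiset.count_erase_self]
  congr 1
  refine Finset.prod_congr rfl fun d hd => ?_
  rw [Multiset.count_erase_of_ne (Finset.ne_of_mem_erase hd)]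

/-- Leibniz rule: each factor contributes its multiplicity minus the removal of one copy, and the
multiplicities add up to the size of `S`. -/
theorem X_mul_derivative_contentPoly {T : Finset α} {S : Multiset α} (hST : S.toFinset ⊆ T)
    (L : List α) :
    X * derivative (contentPoly T S L)
      = (S.card : ℝ[X]) * contentPoly T S L
        - ∑ c ∈ S.toFinset, contentPoly T (S.erase c) L := by
  have hterm : ∀ c ∈ T, X * ((∏ d ∈ T.erase c, letterPoly (d ∈ L) (S.count d)) *
      derivative (letterPoly (c ∈ L) (S.count c)))
      = (S.count c : ℝ[X]) * contentPoly T S L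
        - if c ∈ S.toFinset then contentPoly T (S.erase c) L else 0 := by
    intro c hc
    rw [mul_left_comm]
    split_ifs with h
    · obtain ⟨k, hk⟩ := Nat.exists_eq_add_of_le'
        (Multiset.one_le_count_iff_mem.2 (Multiset.mem_toFinset.1 h))
      rw [contentPoly_erase hc, hk, X_mul_derivative_letterPoly_succ, ← hk, contentPoly,
        ← Finset.prod_erase_mul _ _ hc, hk, Nat.add_sub_cancel]
      ring
    · rw [Multiset.mem_toFinset, ← Multiset.count_eq_zero] at h
      rw [h, X_mul_derivative_letterPoly_zero]
      simp
  rw [contentPoly, derivative_prod_finset, Finset.mul_sum, Finset.sum_congr rfl hterm,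
    Finset.sum_sub_distrib, ← Finset.sum_mul, Finset.sum_ite_mem,
    Finset.inter_eq_right.2 hST]
  congr 2
  rw [← Nat.cast_sum, Multiset.sum_count_eq_card]
  exact fun a ha => hST (Multiset.mem_toFinset.2 ha)

/-- Only reading the head of `L` changes the target, so the X d/dX term must be exactly the
correction to that one summand. -/
theorem borelEval_contentPoly_recursion {T : Finset α} {S : Multiset α} (hST : S.toFinset ⊆ T)
    {L : List α} (hL : L.Nodup) (hLT : ∀ a ∈ L, a ∈ T) :
    (S.card : ℝ) * borelEval 1 (contentPoly T S L)
      = ∑ c ∈ S.toFinset, borelEval 1 (contentPoly T (S.erase c) (advance c L)) := by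
  have hmain : (S.card : ℝ) * borelEval 1 (contentPoly T S L)
      = borelEval 1 (X * derivative (contentPoly T S L))
        + ∑ c ∈ S.toFinset, borelEval 1 (contentPoly T (S.erase c) L) := by
    rw [X_mul_derivative_contentPoly hST, map_sub, map_sum, sub_add_cancel, ← smul_eq_mul,
      ← map_smul, Nat.cast_smul_eq_nsmul, nsmul_eq_mul]
  rw [hmain]
  cases L with
  | nil =>
    have : derivative (contentPoly T S []) = 0 := by
      simp [contentPoly, letterPoly, ← map_prod]
    simp [this, advance]
  | cons a L =>
    have haT : a ∈ T := hLT a (by simp)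
    have haL : a ∉ L := (List.nodup_cons.1 hL).1
    have hadv : ∀ c, c ≠ a → advance c (a :: L) = a :: L := by
      intro c hc; simp [advance, hc.symm]
    by_cases haS : a ∈ S.toFinset
    · rw [← Finset.sum_erase_add _ _ haS, ← Finset.sum_erase_add _ _ haS, add_left_comm]
      congr 1
      · refine Finset.sum_congr rfl fun c hc => ?_
        rw [hadv c (Finset.ne_of_mem_erase hc)]
      · obtain ⟨k, hk⟩ := Nat.exists_eq_add_of_le'
          (Multiset.one_le_count_iff_mem.2 (Multiset.mem_toFinset.1 haS))
        have hrest : ∏ d ∈ T.erase a, letterPoly (d ∈ a :: L) (S.count d)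
            = ∏ d ∈ T.erase a, letterPoly (d ∈ L) (S.count d) := by
          refine Finset.prod_congr rfl fun d hd => ?_
          have : d ∈ a :: L ↔ d ∈ L := by simp [Finset.ne_of_mem_erase hd]
          simp only [letterPoly, this]
        -- This is the recursion of `hitPoly` in the factor of `a`; the outer X is what lets
        -- `borelEval 1` undo X d/dX.
        have h1 : contentPoly T S (a :: L)
            = X * (contentPoly T (S.erase a) L - contentPoly T (S.erase a) (a :: L)) := by
          rw [contentPoly_erase haT, contentPoly_erase haT, hrest, contentPoly,
            ← Finset.prod_erase_mul _ _ haT, hrest, hk, Nat.add_sub_cancel]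
          simp only [letterPoly, List.mem_cons, true_or, if_true, haL, if_false, hitPoly]
          ring
        have h2 : advance a (a :: L) = L := by simp [advance]
        rw [h1, borelEval_X_mul_derivative_X_mul, h2, map_sub, sub_add_cancel]
    · have h0 : contentPoly T S (a :: L) = 0 := by
        refine Finset.prod_eq_zero haT ?_
        rw [Multiset.mem_toFinset, ← Multiset.count_eq_zero] at haS
        simp [haS, letterPoly, hitPoly]
      rw [h0]
      simp only [mul_zero, map_zero, zero_add]
      refine Finset.sum_congr rfl fun c hc => ?_
      rw [hadv c (fun h => haS (h ▸ hc))]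

theorem card_wordsContaining {T : Finset α} (S : Multiset α) (hST : S.toFinset ⊆ T)
    {L : List α} (hL : L.Nodup) (hLT : ∀ a ∈ L, a ∈ T) :
    ((wordsContaining S L).card : ℝ)
      = (S.card.factorial : ℝ) * borelEval 1 (contentPoly T S L) := by
  induction hk : S.card generalizing S L with
  | zero =>
    obtain rfl := Multiset.card_eq_zero.1 hk
    cases L with
    | nil =>
      have h1 : wordsContaining (0 : Multiset α) [] = {[]} := by
        ext w; simp [mem_wordsContaining]
      have h2 : contentPoly T (0 : Multiset α) [] = C 1 := by simp [contentPoly, letterPoly]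
      rw [h1, h2, borelEval_C]
      simp
    | cons a L =>
      have h1 : wordsContaining (0 : Multiset α) (a :: L) = ∅ := by
        ext w
        simp only [mem_wordsContaining, Multiset.coe_eq_zero, Finset.notMem_empty, iff_false]
        rintro ⟨rfl, h⟩
        simp at h
      have h2 : contentPoly T (0 : Multiset α) (a :: L) = 0 :=
        Finset.prod_eq_zero (hLT a (by simp)) (by simp [letterPoly, hitPoly])
      simp [h1, h2]
  | succ k ih =>
    have hS : S ≠ 0 := by rintro rfl; simp at hk
    rw [card_wordsContaining_eq_sum hS, Nat.cast_sum, Nat.factorial_succ, Nat.cast_mul,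
      mul_comm ((k + 1 : ℕ) : ℝ), mul_assoc, ← hk, borelEval_contentPoly_recursion hST hL hLT,
      Finset.mul_sum]
    have hsub : ∀ c, (advance c L).Sublist L := by
      intro c
      cases L with
      | nil => simp [advance]
      | cons a L => rw [advance]; split_ifs <;> simp
    refine Finset.sum_congr rfl fun c hc => ih (S.erase c) ?_ (hL.sublist (hsub c))
      (fun a ha => hLT a ((hsub c).subset ha)) ?_
    · exact (Multiset.toFinset_subset.2 (Multiset.erase_subset c S)).trans hST
    · rw [Multiset.card_erase_of_mem (Multiset.mem_toFinset.1 hc), hk, Nat.pred_succ]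

end Words
/-! ### Sums of independent beta variables -/

section Beta

open Polynomial Set

theorem continuous_borelEval (p : ℝ[X]) : Continuous fun x => borelEval x p := by
  simp only [fun x => borelEval_eq_sum_range x (le_refl p.natDegree)]
  fun_prop

/-- Integration by parts lowers `k` and raises `b`, and its boundary term at 0 is the constant in
the recursion of `hitPoly`. -/
theorem integral_one_sub_pow_mul_sub_pow (x : ℝ) (k b : ℕ) :
    ∫ y in (0 : ℝ)..x, (1 - y) ^ k / (k.factorial : ℝ) * ((x - y) ^ b / (b.factorial : ℝ))
      = borelEval x (hitPoly (k + 1) * monomial b 1) := by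
  have hd : ∀ (a : ℝ) (j : ℕ) (y : ℝ), HasDerivAt
      (fun y => -((a - y) ^ (j + 1) / ((j + 1).factorial : ℝ))) ((a - y) ^ j / (j.factorial : ℝ)) y := by
    intro a j y
    have h := ((((hasDerivAt_id y).const_sub a).pow (j + 1)).div_const
      ((j + 1).factorial : ℝ)).neg
    convert! h using 1
    simp only [id, Nat.factorial_succ, Nat.add_sub_cancel]
    push_cast
    field_simp
  have hc : ∀ (a : ℝ) (j : ℕ), Continuous fun y : ℝ => (a - y) ^ j / (j.factorial : ℝ) := by
    intro a j; fun_prop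
  induction k generalizing b with
  | zero =>
    have h1 : hitPoly (0 + 1) * monomial b 1 = monomial (b + 1) 1 := by
      simp [hitPoly, X_mul_monomial]
    rw [h1, borelEval_monomial]
    simp only [pow_zero, Nat.factorial_zero, Nat.cast_one, div_one, one_mul]
    rw [intervalIntegral.integral_eq_sub_of_hasDerivAt (fun y _ => hd x b y)
      ((hc x b).intervalIntegrable _ _)]
    simp
  | succ k ih =>
    have hp := intervalIntegral.integral_mul_deriv_eq_deriv_mul
      (a := 0) (b := x) (u := fun y => -(-((1 - y) ^ (k + 1) / ((k + 1).factorial : ℝ))))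
      (u' := fun y => -((1 - y) ^ k / (k.factorial : ℝ)))
      (v := fun y => -((x - y) ^ (b + 1) / ((b + 1).factorial : ℝ)))
      (v' := fun y => (x - y) ^ b / (b.factorial : ℝ))
      (fun y _ => (hd 1 k y).neg) (fun y _ => hd x b y)
      ((hc 1 k).neg.intervalIntegrable _ _) ((hc x b).intervalIntegrable _ _)
    simp only [neg_neg, neg_mul_neg] at hp
    rw [hp, ih (b + 1)]
    have h1 : hitPoly (k + 1 + 1) * monomial b 1
        = monomial (b + 1) (1 / ((k + 1).factorial : ℝ)) - hitPoly (k + 1) * monomial (b + 1) 1 := by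
      rw [hitPoly, ← X_mul_monomial, mul_comm X, mul_assoc, X_mul_monomial, sub_mul,
        C_mul_monomial, mul_one, X_mul_monomial]
    rw [h1, map_sub, borelEval_monomial]
    simp
    ring

theorem integral_one_sub_pow_mul_borelEval (x : ℝ) (k : ℕ) (p : ℝ[X]) :
    ∫ y in (0 : ℝ)..x, (1 - y) ^ k / (k.factorial : ℝ) * borelEval (x - y) p
      = borelEval x (hitPoly (k + 1) * p) := by
  have hc : ∀ q : ℝ[X], Continuous fun y : ℝ =>
      (1 - y) ^ k / (k.factorial : ℝ) * borelEval (x - y) q := fun q =>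
    Continuous.mul (by fun_prop) ((continuous_borelEval q).comp (by fun_prop))
  induction p using Polynomial.induction_on' with
  | add p q hp hq =>
    simp only [mul_add, map_add]
    rw [intervalIntegral.integral_add ((hc p).intervalIntegrable _ _)
      ((hc q).intervalIntegrable _ _), hp, hq]
  | monomial b c =>
    have h : (monomial b c : ℝ[X]) = c • monomial b 1 := by simp [smul_monomial]
    rw [h, mul_smul_comm, map_smul, ← integral_one_sub_pow_mul_sub_pow, smul_eq_mul,
      ← intervalIntegral.integral_const_mul]
    congr 1
    ext y
    rw [map_smul, borelEval_monomial, smul_eq_mul]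
    ring

theorem betaPDF_one_succ {k : ℕ} {y : ℝ} (h0 : 0 < y) (h1 : y < 1) :
    betaPDF 1 ((k + 1 : ℕ) : ℝ) y = ENNReal.ofReal (((k + 1 : ℕ) : ℝ) * (1 - y) ^ k) := by
  rw [betaPDF_of_pos_lt_one h0 h1]
  have h : beta 1 ((k + 1 : ℕ) : ℝ) = 1 / ((k + 1 : ℕ) : ℝ) := by
    have h2 : (1 : ℝ) + ((k + 1 : ℕ) : ℝ) = ((k + 1 : ℕ) : ℝ) + 1 := add_comm _ _
    have h3 : ((k + 1 : ℕ) : ℝ) = (k : ℝ) + 1 := by push_cast; rfl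
    rw [beta, h2, Real.Gamma_nat_eq_factorial, h3, Real.Gamma_nat_eq_factorial, Real.Gamma_one,
      Nat.factorial_succ]
    push_cast
    field_simp
  rw [h, sub_self, Real.rpow_zero]
  congr 1
  have h4 : ((k + 1 : ℕ) : ℝ) - 1 = (k : ℝ) := by push_cast; ring
  rw [h4, Real.rpow_natCast]
  simp

theorem betaMeasure_conv_apply {α β : ℝ} {ν : Measure ℝ} [SFinite ν] {s : Set ℝ}
    (hs : MeasurableSet s) :
    (betaMeasure α β ∗ ν) s = ∫⁻ y, betaPDF α β y * ν ((fun z => y + z) ⁻¹' s) := by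
  have hm : Measurable fun y => ν ((fun z : ℝ => y + z) ⁻¹' s) :=
    measurable_measure_prodMk_left (ν := ν) (measurable_add hs)
  have hb : Measurable (betaPDF α β) := (measurable_betaPDFReal α β).ennreal_ofReal
  rw [betaMeasure, Measure.conv, Measure.map_apply measurable_add hs,
    Measure.prod_apply (measurable_add hs)]
  exact lintegral_withDensity_eq_lintegral_mul _ hb hm

theorem betaMeasure_conv_Iio_zero {α β : ℝ} {ν : Measure ℝ} [SFinite ν] (hν : ν (Iio 0) = 0) :
    (betaMeasure α β ∗ ν) (Iio 0) = 0 := by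
  rw [betaMeasure_conv_apply measurableSet_Iio]
  refine (lintegral_congr fun y => ?_).trans lintegral_zero
  rcases le_or_gt y 0 with hy | hy
  · rw [betaPDF_eq_zero_of_nonpos hy, zero_mul]
  · have hsub : (fun z => y + z) ⁻¹' Iio 0 ⊆ Iio 0 := fun z (hz : y + z < 0) =>
      mem_Iio.2 (by linarith)
    rw [measure_mono_null hsub hν, mul_zero]

/-- Since x ≤ 1 and `ν` lives on [0, ∞), only 0 < y ≤ x matters, where the beta density is the
polynomial (k+1)(1 - y)^k almost everywhere. -/
theorem betaMeasure_conv_Iic {ν : Measure ℝ} [IsProbabilityMeasure ν] {p : ℝ[X]}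
    (h0 : ν (Iio 0) = 0) (hp : ∀ x ∈ Icc (0 : ℝ) 1, ν.real (Iic x) = borelEval x p) (k : ℕ)
    {x : ℝ} (hx : x ∈ Icc (0 : ℝ) 1) :
    (betaMeasure 1 ((k + 1 : ℕ) : ℝ) ∗ ν).real (Iic x)
      = borelEval x (C ((k + 1).factorial : ℝ) * hitPoly (k + 1) * p) := by
  have hae : (fun y => betaPDF 1 ((k + 1 : ℕ) : ℝ) y * ν ((fun z => y + z) ⁻¹' Iic x))
      =ᵐ[volume] (Ioc 0 x).indicator fun y =>
        ENNReal.ofReal (((k + 1 : ℕ) : ℝ) * (1 - y) ^ k * borelEval (x - y) p) := by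
    -- The point y = x is discarded because the density formula needs y < 1, and x may be 1.
    filter_upwards [compl_mem_ae_iff.2 (measure_singleton x)] with y hyx
    have hpre : (fun z => y + z) ⁻¹' Iic x = Iic (x - y) := by
      ext z; simp [le_sub_iff_add_le, add_comm]
    rw [hpre]
    rcases le_or_gt y 0 with hy | hy
    · rw [betaPDF_eq_zero_of_nonpos hy, indicator_of_notMem (fun h => hy.not_gt h.1), zero_mul]
    · rcases lt_or_gt_of_ne (show y ≠ x from hyx) with hlt | hgt
      · rw [indicator_of_mem (mem_Ioc.2 ⟨hy, hlt.le⟩),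
          betaPDF_one_succ hy (hlt.trans_le hx.2),
          ← hp (x - y) ⟨by linarith, by linarith [hx.2]⟩, ENNReal.ofReal_mul' measureReal_nonneg,
          ofReal_measureReal]
      · rw [indicator_of_notMem (fun h => hgt.not_ge h.2),
          measure_mono_null (Iic_subset_Iio.2 (by linarith)) h0, mul_zero]
  have hc : Continuous fun y => ((k + 1 : ℕ) : ℝ) * (1 - y) ^ k * borelEval (x - y) p :=
    Continuous.mul (by fun_prop) ((continuous_borelEval p).comp (by fun_prop))
  have hnn : ∀ y ∈ Ioc 0 x, 0 ≤ ((k + 1 : ℕ) : ℝ) * (1 - y) ^ k * borelEval (x - y) p := by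
    intro y hy
    rw [← hp (x - y) ⟨by linarith [hy.2], by linarith [hx.2, hy.1]⟩]
    have : 0 ≤ 1 - y := by linarith [hy.2, hx.2]
    positivity
  rw [Measure.real, betaMeasure_conv_apply measurableSet_Iic, lintegral_congr_ae hae,
    lintegral_indicator measurableSet_Ioc, ← integral_eq_lintegral_of_nonneg_ae
      ((ae_restrict_iff' measurableSet_Ioc).2 (Filter.Eventually.of_forall hnn))
      hc.aestronglyMeasurable,
    ← intervalIntegral.integral_of_le hx.1, mul_assoc, ← smul_eq_C_mul, map_smul,
    ← integral_one_sub_pow_mul_borelEval, smul_eq_mul, ← intervalIntegral.integral_const_mul]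
  congr 1
  ext y
  rw [Nat.factorial_succ]
  push_cast
  field_simp

theorem measureReal_sum_beta_le {Ω ι : Type*} [MeasurableSpace Ω] {μ : Measure Ω}
    [IsProbabilityMeasure μ] {X : ι → Ω → ℝ} {m : ι → ℕ} (hm : ∀ i, 1 ≤ m i)
    (hX : iIndepFun X μ) (hlaw : ∀ i, HasLaw (X i) (betaMeasure 1 (m i : ℝ)) μ) (s : Finset ι)
    {x : ℝ} (hx : x ∈ Icc (0 : ℝ) 1) :
    μ.real {ω | ∑ i ∈ s, X i ω ≤ x}
      = (∏ i ∈ s, ((m i).factorial : ℝ)) * borelEval x (∏ i ∈ s, hitPoly (m i)) := by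
  classical
  have hmeas : ∀ s : Finset ι, AEMeasurable (∑ i ∈ s, X i) μ := fun s =>
    Finset.aemeasurable_sum s fun i _ => (hlaw i).aemeasurable
  -- Nonnegativity and all x in [0, 1] are carried along, as the convolution step uses both.
  have key : μ.map (∑ i ∈ s, X i) (Iio 0) = 0 ∧ ∀ x ∈ Icc (0 : ℝ) 1,
      (μ.map (∑ i ∈ s, X i)).real (Iic x)
        = borelEval x (∏ i ∈ s, (C ((m i).factorial : ℝ) * hitPoly (m i))) := by
    induction s using Finset.induction_on with
    | empty =>
      have h : μ.map (∑ i ∈ (∅ : Finset ι), X i) = Measure.dirac 0 := by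
        rw [Finset.sum_empty]
        change μ.map (fun _ => (0 : ℝ)) = _
        rw [Measure.map_const, measure_univ, one_smul]
      rw [h]
      refine ⟨by simp, fun x hx => ?_⟩
      rw [Finset.prod_empty, ← C_1, borelEval_C, Measure.real, Measure.dirac_apply' _ measurableSet_Iic]
      simp [hx.1]
    | insert a s ha ih =>
      have hconv : μ.map (∑ i ∈ insert a s, X i)
          = betaMeasure 1 (m a : ℝ) ∗ μ.map (∑ i ∈ s, X i) := by
        rw [Finset.sum_insert ha, ← (hlaw a).map_eq]
        exact ((hX.indepFun_finsetSum_of_notMem₀ (fun i => (hlaw i).aemeasurable) ha).symm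
          ).map_add_eq_map_conv_map₀ (hlaw a).aemeasurable (hmeas s)
      have := Measure.isProbabilityMeasure_map (hmeas s)
      obtain ⟨k, hk⟩ := Nat.exists_eq_add_of_le' (hm a)
      rw [hconv]
      refine ⟨betaMeasure_conv_Iio_zero ih.1, fun x hx => ?_⟩
      rw [Finset.prod_insert ha, hk, betaMeasure_conv_Iic ih.1 ih.2 k hx]
  have hset : {ω | ∑ i ∈ s, X i ω ≤ x} = (∑ i ∈ s, X i) ⁻¹' Iic x := by
    ext ω; simp [Finset.sum_apply]
  rw [hset, ← map_measureReal_apply_of_aemeasurable (hmeas s) measurableSet_Iic, key.2 x hx,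
    Finset.prod_mul_distrib, ← map_prod C, ← smul_eq_C_mul, map_smul, smul_eq_mul]

end Beta
/-! ### Permutations of the multiset `1^{m_1} ⋯ n^{m_n}` -/

theorem count_multisetOf {n : ℕ} (m : Fin n → ℕ) (i : Fin n) :
    (multisetOf m).count ((i : ℕ) + 1) = m i := by
  rw [multisetOf, Multiset.count_sum']
  simp [Multiset.count_replicate, Fin.val_inj]

theorem card_multisetOf {n : ℕ} (m : Fin n → ℕ) : (multisetOf m).card = ∑ i, m i := by
  simp [multisetOf]

theorem multisetPerms_filter {n : ℕ} (m : Fin n → ℕ) (L : List ℕ) :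
    (multisetPerms m).filter (fun w => L.Sublist w) = wordsContaining (multisetOf m) L := rfl

/-- The number of permutations of `1^{m_1} ⋯ n^{m_n}` containing a given word with distinct
letters from `1, …, n`. -/
theorem card_wordsContaining_multisetOf {n : ℕ} (m : Fin n → ℕ) {L : List ℕ} (hL : L.Nodup)
    (hLn : ∀ a ∈ L, 1 ≤ a ∧ a ≤ n) :
    ((wordsContaining (multisetOf m) L).card : ℝ) = ((∑ i, m i).factorial : ℝ) *
      borelEval 1 (∏ i : Fin n, letterPoly ((i : ℕ) + 1 ∈ L) (m i)) := by
  have hT : ∀ a, 1 ≤ a ∧ a ≤ n → a ∈ (Finset.univ : Finset (Fin n)).image fun i : Fin n => (i : ℕ) + 1 :=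
    fun a ha => Finset.mem_image.2 ⟨⟨a - 1, by omega⟩, Finset.mem_univ _, by simp; omega⟩
  rw [card_wordsContaining (multisetOf m) _ hL fun a ha => hT a (hLn a ha), card_multisetOf,
    contentPoly, Finset.prod_image fun i _ j _ h => Fin.ext (Nat.succ_injective h)]
  · simp only [count_multisetOf]
  · intro a ha
    rw [Multiset.mem_toFinset, multisetOf, Multiset.mem_sum] at ha
    obtain ⟨i, -, hi⟩ := ha
    exact Finset.mem_image.2 ⟨i, Finset.mem_univ _, (Multiset.eq_of_mem_replicate hi).symm⟩

/-- With the empty subsequence every factor is a constant 1/m_i!, which gives the multinomial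
coefficient. -/
theorem card_multisetPerms {n : ℕ} (m : Fin n → ℕ) :
    ((multisetPerms m).card : ℝ)
      = ((∑ i, m i).factorial : ℝ) / ∏ i, ((m i).factorial : ℝ) := by
  have h := card_wordsContaining_multisetOf m (L := []) List.nodup_nil (by simp)
  rw [← multisetPerms_filter] at h
  simp only [List.nil_sublist, Finset.filter_true, letterPoly, List.not_mem_nil, if_false,
    ← map_prod, borelEval_C] at h
  rw [h]
  simp [div_eq_mul_inv]

theorem card_range'_sublist {n : ℕ} (m : Fin n → ℕ) :
    (((multisetPerms m).filter (fun w => (List.range' 1 n).Sublist w)).card : ℝ)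
      = ((∑ i, m i).factorial : ℝ) * borelEval 1 (∏ i, hitPoly (m i)) := by
  rw [multisetPerms_filter, card_wordsContaining_multisetOf m List.nodup_range' (fun a ha => by
    rw [List.mem_range'_1] at ha; omega)]
  congr 2
  refine Finset.prod_congr rfl fun i _ => ?_
  rw [letterPoly, if_pos (List.mem_range'_1.2 ⟨by omega, by omega⟩)]

theorem longestContinuous_eq_iff {n : ℕ} (hn : 1 ≤ n) (w : List ℕ) :
    longestContinuous n w = n ↔ (List.range' 1 n).Sublist w := by
  rw [longestContinuous, Nat.findGreatest_eq_iff]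
  -- `Nat.findGreatest` guarantees its predicate only at a nonzero value, hence 1 ≤ n.
  exact ⟨fun h => h.2.1 (by omega), fun h => ⟨le_rfl, fun _ => h, fun k hk hk' => by omega⟩⟩

theorem lawL_self_toReal {n : ℕ} (hn : 1 ≤ n) (m : Fin n → ℕ) :
    (lawL m n).toReal
      = (((multisetPerms m).filter (fun w => (List.range' 1 n).Sublist w)).card : ℝ)
        / ((multisetPerms m).card : ℝ) := by
  have h : lawL m n = (uniformMultisetPerm m).toOuterMeasure
      {w | (List.range' 1 n).Sublist w} := by
    rw [lawL, ← PMF.toOuterMeasure_apply_singleton, PMF.toOuterMeasure_map_apply]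
    congr 1
    ext w
    exact longestContinuous_eq_iff hn w
  rw [h, uniformMultisetPerm, PMF.toOuterMeasure_uniformOfFinset_apply, ENNReal.toReal_div,
    ENNReal.toReal_natCast, ENNReal.toReal_natCast]
  congr!

theorem mainTheorem9 {n : ℕ} (hn : 1 ≤ n) (m : Fin n → ℕ) (hm : ∀ i, 1 ≤ m i)
    (M : ℕ) (hM : M = ∑ i, m i) :
    -- the count, through the uniformly random permutation
    (((multisetPerms m).filter (fun w => (List.range' 1 n).Sublist w)).card : ℝ)
        = (M.factorial : ℝ) / (∏ i, ((m i).factorial : ℝ)) * (lawL m n).toReal ∧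
    -- the explicit formula for the count
    (((multisetPerms m).filter (fun w => (List.range' 1 n).Sublist w)).card : ℝ)
        = (-1) ^ M * ∑ j ∈ Finset.range (M + 1),
            (M.choose j : ℝ) * (j.factorial : ℝ) * coeffC m j ∧
    -- the count, through sums of independent beta variables
    (∀ {Ω : Type*} [MeasurableSpace Ω] (μ : Measure Ω) [IsProbabilityMeasure μ]
        (X : Fin n → Ω → ℝ),
        iIndepFun X μ → (∀ i, HasLaw (X i) (betaMeasure 1 (m i : ℝ)) μ) →
        (((multisetPerms m).filter (fun w => (List.range' 1 n).Sublist w)).card : ℝ)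
          = (M.factorial : ℝ) / (∏ i, ((m i).factorial : ℝ)) *
              μ.real {ω | ∑ i, X i ω ≤ 1}) := by
  subst hM
  have hfac : (∏ i, ((m i).factorial : ℝ)) ≠ 0 :=
    Finset.prod_ne_zero_iff.2 fun i _ => by positivity
  refine ⟨?_, ?_, ?_⟩
  · rw [lawL_self_toReal hn, ← card_multisetPerms, mul_div_cancel₀]
    exact Nat.cast_ne_zero.2 (Finset.card_ne_zero.2 (multisetPerms_nonempty m))
  · rw [card_range'_sublist, factorial_mul_borelEval_prod_hitPoly m hm]
  · intro Ω _ μ _ X hX hlaw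
    rw [card_range'_sublist, measureReal_sum_beta_le hm hX hlaw Finset.univ (by simp)]
    field_simp
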